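/- Let $d\ge 1$ and let $X_1,\dots,X_{d+2}$ be (possibly dependent) random vectors in $\mathbb{R}^{d+1}$, defined on a common probability space, which are almost surely in general linear position, i.e. almost surely any $d+1$ of them are linearly independent. Let $$C=\operatorname{pos}(X_1,\dots,X_{d+2})=\Big\{\sum_{i=1}^{d+2}\lambda_iX_i:\lambda_1,\dots,\lambda_{d+2}\ge 0\Big\},\qquad Q=C\cap\mathbb{S}^d,$$ where $\mathbb{S}^d$ is the unit sphere in $\mathbb{R}^{d+1}$. For $j\in\{0,\dots,d\}$ let $f_j(Q)$ be the number of $j$-dimensional faces of the spherical polytope $Q$, that is, the number of $(j+1)$-dimensional faces of the cone $C$, and put $f_{-1}(Q)=1$ if $Q\ne\mathbb{S}^d$ and $f_{-1}(Q)=0$ if $Q=\mathbb{S}^d$. For $m\in\{-1,0,\dots,\lfloor d/2\rfloor\}$ say that $Q$ is of type $T_m^d$ if $f_{d-1}(Q)=(m+1)(d+1-m)$. Let $\eta_{d,m}=2$ if $m\neq d/2$ and $\eta_{d,m}=1$ if $m=d/2$. Then, for every $m\in\{-1,0,\dots,\lfloor d/2\rfloor\}$, the event that $Q$ is of type $T_m^d$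 is measurable up to null sets, the random variables $f_{-1}(Q),\dots,f_m(Q)$ are integrable, and $$\mathbb{P}[Q\text{ is of type }T_m^d]=\frac12\,\eta_{d,m}\sum_{\ell=-1}^{m}(-1)^{m+\ell}\binom{d-\ell+1}{d-m+1}\left(\binom{d+2}{\ell+1}-\mathbb{E}f_\ell(Q)\right).$$ -/

import Mathlib

open MeasureTheory

noncomputable section

namespace SphericalSylvester

/-- The positive hull `pos(x_i)`: all linear combinations of the `x_i` with nonnegative
coefficients. -/
def posHull {n k : ℕ} (x : Fin n → EuclideanSpace ℝ (Fin k)) :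
    PointedCone ℝ (EuclideanSpace ℝ (Fin k)) :=
  PointedCone.hull ℝ (Set.range x)

/-- The part of a cone lying on the unit sphere; for `C = pos(x_i)` this is the spherical polytope
spanned by the `x_i`. -/
def sphericalPart {k : ℕ} (C : PointedCone ℝ (EuclideanSpace ℝ (Fin k))) :
    Set (EuclideanSpace ℝ (Fin k)) :=
  (C : Set (EuclideanSpace ℝ (Fin k))) ∩ Metric.sphere 0 1

/-- The number `f_j(C)` of `j`-dimensional faces of the cone `C`, where the dimension of a face is
the dimension of its linear span. The cone itself counts as a face. -/
def coneFaceNumber {k : ℕ} (C : PointedCone ℝ (EuclideanSpace ℝ (Fin k))) (j : ℕ) : ℕ :=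
  Set.ncard {F : PointedCone ℝ (EuclideanSpace ℝ (Fin k)) |
    F.IsFaceOf C ∧
      Module.finrank ℝ (Submodule.span ℝ (F : Set (EuclideanSpace ℝ (Fin k)))) = j}

open Classical in
/-- The face number `f_j(Q)`, `j ≥ -1`, of the spherical polytope `Q` cut out by the cone `C`:
`f_j(Q) = f_{j+1}(C)` for `j ≥ 0`, while `f_{-1}(Q)` indicates that `Q` is not the whole sphere. -/
def sphericalFaceNumber {k : ℕ} (C : PointedCone ℝ (EuclideanSpace ℝ (Fin k))) (j : ℤ) : ℕ :=
  if j = -1 then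
    if sphericalPart C ≠ Metric.sphere 0 1 then 1 else 0
  else coneFaceNumber C (j + 1).toNat

/-- The spherical polytope `Q` in the `d`-dimensional sphere cut out by `C` has combinatorial type
`T_m^d` if it has `(m+1)(d+1-m)` facets, that is, faces of dimension `d-1`. -/
def HasType {d : ℕ} (C : PointedCone ℝ (EuclideanSpace ℝ (Fin (d + 1)))) (m : ℤ) : Prop :=
  (sphericalFaceNumber C ((d : ℤ) - 1) : ℤ) = (m + 1) * ((d : ℤ) + 1 - m)

/-- `d + 2` vectors in `ℝ^{d+1}` are in general linear position if any `d + 1` of them are linearly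
independent. -/
def GeneralLinearPosition {d : ℕ} (x : Fin (d + 2) → EuclideanSpace ℝ (Fin (d + 1))) : Prop :=
  ∀ s : Finset (Fin (d + 2)), s.card = d + 1 →
    LinearIndepOn ℝ x (s : Set (Fin (d + 2)))

/-- `η_{d,m} = 2` if `m ≠ d/2`, and `η_{d,m} = 1` if `m = d/2`. -/
def eta (d : ℕ) (m : ℤ) : ℝ := if 2 * m = (d : ℤ) then 1 else 2

/-- The binomial coefficient of two integers, used here only with nonnegative entries. -/
def binom (a b : ℤ) : ℝ := (a.toNat.choose b.toNat : ℝ)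

end SphericalSylvester

end

namespace SphericalSylvester

section Faces

variable {ι E : Type*} [Fintype ι] [AddCommGroup E] [Module ℝ E] {x : ι → E} {a : ι → ℝ}

/-- Up to scaling, `a` is the only linear relation between the vectors `x i`, and all its
coefficients are nonzero. -/
structure IsCircuit (x : ι → E) (a : ι → ℝ) : Prop where
  sum_eq_zero : ∑ i, a i • x i = 0
  ne_zero : ∀ i, a i ≠ 0
  unique : ∀ c : ι → ℝ, ∑ i, c i • x i = 0 → ∃ t : ℝ, ∀ i, c i = t * a i

/-- The indices with positive coefficient. -/
noncomputable def posIndices (a : ι → ℝ) : Finset ι := {i | 0 < a i}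

/-- The indices with negative coefficient. -/
noncomputable def negIndices (a : ι → ℝ) : Finset ι := {i | a i < 0}

lemma mem_hull_image_iff {S : Set ι} {z : E} :
    z ∈ PointedCone.hull ℝ (x '' S) ↔
      ∃ c : ι → ℝ, (∀ i, 0 ≤ c i) ∧ (∀ i ∉ S, c i = 0) ∧ ∑ i, c i • x i = z := by
  classical
  constructor
  · intro hz
    induction hz using Submodule.span_induction with
    | mem z hz =>
      obtain ⟨i, hi, rfl⟩ := hz
      refine ⟨Pi.single i 1, fun j => ?_, fun j hj => ?_, ?_⟩
      · by_cases h : j = i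
        · subst h; simp
        · simp [h]
      · rw [Pi.single_eq_of_ne]
        rintro rfl
        exact hj hi
      · simp [Pi.single_apply, ite_smul]
    | zero => exact ⟨0, by simp, by simp, by simp⟩
    | add y z _ _ hy hz =>
      obtain ⟨c, hc, hc', rfl⟩ := hy
      obtain ⟨e, he, he', rfl⟩ := hz
      refine ⟨c + e, fun i => add_nonneg (hc i) (he i), fun i hi => ?_, ?_⟩
      · simp [hc' i hi, he' i hi]
      · simp [add_smul, Finset.sum_add_distrib]
    | smul r z _ hz =>
      obtain ⟨c, hc, hc', rfl⟩ := hz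
      refine ⟨fun i => r * c i, fun i => mul_nonneg r.2 (hc i), fun i hi => ?_, ?_⟩
      · simp [hc' i hi]
      · rw [Finset.smul_sum]
        refine Finset.sum_congr rfl fun i _ => ?_
        rw [mul_smul]
        rfl
  · rintro ⟨c, hc, hc', rfl⟩
    refine Submodule.sum_mem _ fun i _ => ?_
    by_cases hi : i ∈ S
    · exact PointedCone.smul_mem _ (hc i) (Submodule.subset_span ⟨i, hi, rfl⟩)
    · rw [hc' i hi, zero_smul]
      exact Submodule.zero_mem _

lemma mem_hull_range_iff {z : E} :
    z ∈ PointedCone.hull ℝ (Set.range x) ↔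
      ∃ c : ι → ℝ, (∀ i, 0 ≤ c i) ∧ ∑ i, c i • x i = z := by
  rw [← Set.image_univ, mem_hull_image_iff]
  simp

lemma span_hull (s : Set E) :
    Submodule.span ℝ (PointedCone.hull ℝ s : Set E) = Submodule.span ℝ s :=
  Submodule.span_span_of_tower _ _ _

/-- A face of a finitely generated cone is generated by the generators it contains. -/
lemma isFaceOf_eq_hull {F : PointedCone ℝ E}
    (hF : F.IsFaceOf (PointedCone.hull ℝ (Set.range x))) :
    F = PointedCone.hull ℝ (x '' {i | x i ∈ F}) := by
  apply le_antisymm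
  · intro z hz
    obtain ⟨c, hc, rfl⟩ := mem_hull_range_iff.1 (hF.le hz)
    refine mem_hull_image_iff.2 ⟨c, hc, fun i hi => ?_, rfl⟩
    by_contra h
    exact hi (hF.mem_of_sum_smul_mem (fun i => Submodule.subset_span ⟨i, rfl⟩) hc hz i
      (lt_of_le_of_ne (hc i) (Ne.symm h)))
  · rw [PointedCone.hull, Submodule.span_le]
    rintro _ ⟨i, hi, rfl⟩
    exact hi

namespace IsCircuit

lemma neg (h : IsCircuit x a) : IsCircuit x (-a) where
  sum_eq_zero := by simp [h.sum_eq_zero]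
  ne_zero i := by simpa using h.ne_zero i
  unique c hc := by
    obtain ⟨t, ht⟩ := h.unique c hc
    exact ⟨-t, fun i => by simp [ht i]⟩

lemma linearIndepOn (h : IsCircuit x a) {S : Finset ι} {j : ι} (hj : j ∉ S) :
    LinearIndepOn ℝ x (S : Set ι) := by
  classical
  rw [linearIndepOn_finset_iff]
  intro c hc i hi
  obtain ⟨t, ht⟩ := h.unique (fun i => if i ∈ S then c i else 0) (by
    simpa [ite_smul, Finset.sum_ite_mem] using hc)
  have h0 : t = 0 := by simpa [hj, h.ne_zero j] using ht j
  simpa [hi, h0] using ht i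

lemma finrank_span_image (h : IsCircuit x a) {S : Finset ι} {j : ι} (hj : j ∉ S) :
    Module.finrank ℝ (Submodule.span ℝ (x '' (S : Set ι))) = S.card := by
  have hli := h.linearIndepOn hj
  have : Set.image x S = Set.range (fun i : (S : Set ι) => x i) := by
    rw [Set.image_eq_range]
  rw [this, finrank_span_eq_card hli]
  simp

lemma card_le_finrank_span_range (h : IsCircuit x a) [Nonempty ι] :
    Fintype.card ι ≤ Module.finrank ℝ (Submodule.span ℝ (Set.range x)) + 1 := by
  classical
  obtain ⟨j⟩ := ‹Nonempty ι›
  have h1 := h.finrank_span_image (S := Finset.univ.erase j) (j := j) (by simp)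
  have h2 : (Finset.univ.erase j).card = Fintype.card ι - 1 := by simp
  have : Module.Finite ℝ (Submodule.span ℝ (Set.range x)) :=
    Module.Finite.span_of_finite ℝ (Set.finite_range x)
  have h3 := Submodule.finrank_mono (R := ℝ)
    (Submodule.span_mono (R := ℝ) (Set.image_subset_range x (Finset.univ.erase j : Finset ι)))
  omega

/-- A face containing all generators with positive coefficient is the whole cone. -/
lemma forall_mem_of_posIndices (h : IsCircuit x a) {F : PointedCone ℝ E}
    (hF : F.IsFaceOf (PointedCone.hull ℝ (Set.range x)))
    (hP : ∀ i ∈ posIndices a, x i ∈ F) (i : ι) : x i ∈ F := by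
  by_cases hi : 0 < a i
  · exact hP i (by simpa [posIndices] using hi)
  have hi' : 0 < max (-a i) 0 := by
    have := h.ne_zero i
    rw [lt_max_iff]
    left
    rcases lt_trichotomy (a i) 0 with h | h | h
    · linarith
    · contradiction
    · contradiction
  refine hF.mem_of_sum_smul_mem (c := fun i => max (-a i) 0)
    (fun i => Submodule.subset_span ⟨i, rfl⟩) (fun i => le_max_right _ _) ?_ i hi'
  have : ∑ i, max (-a i) 0 • x i = ∑ i, max (a i) 0 • x i := by
    rw [← sub_eq_zero, ← Finset.sum_sub_distrib, ← neg_eq_zero, ← h.sum_eq_zero,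
      ← Finset.sum_neg_distrib]
    refine Finset.sum_congr rfl fun i _ => ?_
    rw [← sub_smul, ← neg_smul]
    congr 1
    rcases le_total (a i) 0 with h | h
    · rw [max_eq_left (by linarith), max_eq_right h]; ring
    · rw [max_eq_right (by linarith), max_eq_left h]; ring
  rw [this]
  refine Submodule.sum_mem _ fun i _ => ?_
  rcases le_or_gt (a i) 0 with hi | hi
  · rw [max_eq_right hi, zero_smul]
    exact Submodule.zero_mem _
  · exact PointedCone.smul_mem _ (le_max_right _ _) (hP i (by simpa [posIndices] using hi))

lemma forall_mem_of_negIndices (h : IsCircuit x a) {F : PointedCone ℝ E}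
    (hF : F.IsFaceOf (PointedCone.hull ℝ (Set.range x)))
    (hN : ∀ i ∈ negIndices a, x i ∈ F) (i : ι) : x i ∈ F :=
  h.neg.forall_mem_of_posIndices hF
    (fun i hi => hN i (by simpa [posIndices, negIndices] using hi)) i

/-- If `S` misses indices of both signs, then a linear combination which is nonnegative off `S` and
equal to one supported on `S` has the same coefficients. -/
lemma coeff_eq_of_sum_eq (h : IsCircuit x a) {S : Finset ι} (hP : ¬ posIndices a ⊆ S)
    (hN : ¬ negIndices a ⊆ S) {c e : ι → ℝ} (hc : ∀ i, 0 ≤ c i) (he : ∀ i ∉ S, e i = 0)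
    (hce : ∑ i, c i • x i = ∑ i, e i • x i) (i : ι) : c i = e i := by
  obtain ⟨t, ht⟩ := h.unique (fun i => c i - e i) (by
    simp [sub_smul, Finset.sum_sub_distrib, hce])
  obtain ⟨p, hp, hpS⟩ := Finset.not_subset.1 hP
  obtain ⟨n, hn, hnS⟩ := Finset.not_subset.1 hN
  simp only [posIndices, negIndices, Finset.mem_filter, Finset.mem_univ, true_and] at hp hn
  have h1 := ht p
  have h2 := ht n
  have h3 := hc p
  have h4 := hc n
  rw [he p hpS, sub_zero] at h1
  rw [he n hnS, sub_zero] at h2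
  have ht0 : t = 0 := by
    apply le_antisymm
    · by_contra! hlt
      linarith [mul_neg_of_pos_of_neg hlt hn]
    · by_contra! hlt
      linarith [mul_neg_of_neg_of_pos hlt hp]
  have := ht i
  rw [ht0, zero_mul, sub_eq_zero] at this
  exact this

lemma isFaceOf_hull_image (h : IsCircuit x a) {S : Finset ι} (hP : ¬ posIndices a ⊆ S)
    (hN : ¬ negIndices a ⊆ S) :
    (PointedCone.hull ℝ (x '' (S : Set ι))).IsFaceOf (PointedCone.hull ℝ (Set.range x)) where
  le := Submodule.span_mono (Set.image_subset_range _ _)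
  mem_of_smul_add_mem := by
    intro u v r hu hv hr huv
    obtain ⟨c, hc, rfl⟩ := mem_hull_range_iff.1 hu
    obtain ⟨e, he, rfl⟩ := mem_hull_range_iff.1 hv
    obtain ⟨f, hf, hf', hf''⟩ := mem_hull_image_iff.1 huv
    refine mem_hull_image_iff.2 ⟨c, hc, fun i hi => ?_, rfl⟩
    have key := h.coeff_eq_of_sum_eq hP hN (c := fun i => r * c i + e i) (e := f)
      (fun i => add_nonneg (mul_nonneg hr.le (hc i)) (he i)) (fun i hi => hf' i (by simpa using hi))
      (by rw [hf'']; simp [add_smul, mul_smul, Finset.sum_add_distrib, Finset.smul_sum]) i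
    rw [hf' i hi] at key
    have h1 := mul_nonneg hr.le (hc i)
    have h2 : r * c i = 0 := by linarith [he i]
    simpa [hr.ne'] using h2

lemma mem_hull_image_iff_mem (h : IsCircuit x a) {S : Finset ι} (hP : ¬ posIndices a ⊆ S)
    (hN : ¬ negIndices a ⊆ S) {j : ι} :
    x j ∈ PointedCone.hull ℝ (x '' (S : Set ι)) ↔ j ∈ S := by
  classical
  refine ⟨fun hj => ?_, fun hj => Submodule.subset_span ⟨j, hj, rfl⟩⟩
  by_contra hjS
  obtain ⟨e, -, he, hsum⟩ := mem_hull_image_iff.1 hj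
  have key := h.coeff_eq_of_sum_eq hP hN (c := fun i => if i = j then 1 else 0) (e := e)
    (fun i => by split_ifs <;> simp) (fun i hi => he i (by simpa using hi))
    (by rw [hsum]; simp) j
  rw [he j (by simpa using hjS)] at key
  simp at key

/-- The proper faces of the cone over a circuit correspond to the index sets containing neither
all indices with positive nor all indices with negative coefficient. -/
lemma ncard_faces [DecidableEq ι] (h : IsCircuit x a) {k : ℕ} (hk : k + 1 < Fintype.card ι) :
    Set.ncard {F : PointedCone ℝ E | F.IsFaceOf (PointedCone.hull ℝ (Set.range x)) ∧
      Module.finrank ℝ (Submodule.span ℝ (F : Set E)) = k} =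
    (((Finset.univ : Finset ι).powersetCard k).filter
      fun S => ¬ posIndices a ⊆ S ∧ ¬ negIndices a ⊆ S).card := by
  classical
  rw [← Set.ncard_coe_finset, ← Set.InjOn.ncard_image
    (f := fun S : Finset ι => PointedCone.hull ℝ (x '' (S : Set ι)))]
  · congr 1
    ext F
    simp only [Set.mem_ofPred_eq, Set.mem_image, Finset.coe_filter, Finset.mem_powersetCard,
      Finset.subset_univ, true_and]
    constructor
    · rintro ⟨hF, hdim⟩
      have hne : ∃ j, x j ∉ F := by
        by_contra! hall
        have hFC : F = PointedCone.hull ℝ (Set.range x) :=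
          le_antisymm hF.le (Submodule.span_le.2 (by rintro _ ⟨i, rfl⟩; exact hall i))
        rw [hFC, span_hull] at hdim
        have : Nonempty ι := Fintype.card_pos_iff.1 (by omega)
        have := h.card_le_finrank_span_range
        omega
      obtain ⟨j, hj⟩ := hne
      have hFS := isFaceOf_eq_hull hF
      set S : Finset ι := {i | x i ∈ F} with hS
      have hcoe : (S : Set ι) = {i | x i ∈ F} := by simp [hS]
      rw [← hcoe] at hFS
      refine ⟨S, ⟨?_, fun hP => ?_, fun hN => ?_⟩, hFS.symm⟩
      · rw [hFS, span_hull, h.finrank_span_image (j := j) (by simpa [hS] using hj)] at hdim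
        exact hdim
      · exact hj (h.forall_mem_of_posIndices hF (fun i hi => by simpa [hS] using hP hi) j)
      · exact hj (h.forall_mem_of_negIndices hF (fun i hi => by simpa [hS] using hN hi) j)
    · rintro ⟨S, ⟨hcard, hP, hN⟩, rfl⟩
      refine ⟨h.isFaceOf_hull_image hP hN, ?_⟩
      obtain ⟨j, -, hj⟩ := Finset.not_subset.1 hP
      rw [span_hull, h.finrank_span_image hj, hcard]
  · intro S hS T hT hST
    simp only [Finset.coe_filter, Finset.mem_powersetCard, Set.mem_ofPred_eq] at hS hT
    ext j
    rw [← h.mem_hull_image_iff_mem hS.2.1 hS.2.2, ← h.mem_hull_image_iff_mem hT.2.1 hT.2.2]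
    simp only at hST
    rw [hST]

lemma disjoint_posIndices_negIndices (a : ι → ℝ) : Disjoint (posIndices a) (negIndices a) := by
  rw [Finset.disjoint_left]
  intro i hi hi'
  simp only [posIndices, negIndices, Finset.mem_filter, Finset.mem_univ, true_and] at hi hi'
  linarith

lemma card_posIndices_add_card_negIndices (h : IsCircuit x a) :
    (posIndices a).card + (negIndices a).card = Fintype.card ι := by
  classical
  rw [← Finset.card_union_of_disjoint (disjoint_posIndices_negIndices a), ← Finset.card_univ]
  congr 1
  ext i
  have := h.ne_zero i
  simpa [posIndices, negIndices] using this.symm.lt_or_gt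

end IsCircuit

lemma card_filter_superset_powersetCard [DecidableEq ι] (P : Finset ι) {k : ℕ}
    (hk : k ≤ Fintype.card ι) :
    (((Finset.univ : Finset ι).powersetCard k).filter fun S => P ⊆ S).card =
      (Fintype.card ι - P.card).choose (Fintype.card ι - k) := by
  rw [← Finset.card_compl, ← Finset.card_powersetCard]
  refine Finset.card_bij' (fun S _ => Sᶜ) (fun S _ => Sᶜ) ?_ ?_ (by simp) (by simp)
  · intro S hS
    simp only [Finset.mem_filter, Finset.mem_powersetCard] at hS ⊢
    exact ⟨Finset.compl_subset_compl.2 hS.2, by rw [Finset.card_compl, hS.1.2]⟩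
  · intro S hS
    simp only [Finset.mem_filter, Finset.mem_powersetCard] at hS ⊢
    refine ⟨⟨Finset.subset_univ _, by rw [Finset.card_compl, hS.2]; omega⟩, ?_⟩
    rw [← Finset.compl_subset_compl, compl_compl]
    exact hS.1

namespace IsCircuit

/-- The face numbers of the cone over a circuit. -/
lemma ncard_faces_add (h : IsCircuit x a) {k : ℕ} (hk : k + 1 < Fintype.card ι) :
    Set.ncard {F : PointedCone ℝ E | F.IsFaceOf (PointedCone.hull ℝ (Set.range x)) ∧
      Module.finrank ℝ (Submodule.span ℝ (F : Set E)) = k} +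
    ((posIndices a).card.choose (Fintype.card ι - k) +
      (negIndices a).card.choose (Fintype.card ι - k)) = (Fintype.card ι).choose k := by
  classical
  have hsum := h.card_posIndices_add_card_negIndices
  have hP := card_filter_superset_powersetCard (posIndices a) (k := k) (by omega)
  have hN := card_filter_superset_powersetCard (negIndices a) (k := k) (by omega)
  rw [show Fintype.card ι - (posIndices a).card = (negIndices a).card by omega] at hP
  rw [show Fintype.card ι - (negIndices a).card = (posIndices a).card by omega] at hN
  rw [h.ncard_faces hk, ← hP, ← hN, add_comm (Finset.card (Finset.filter (negIndices a ⊆ ·) _)),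
    ← Finset.card_union_of_disjoint, ← Finset.filter_or, ← Finset.card_univ (α := ι),
    ← Finset.card_powersetCard, add_comm]
  · simp only [← not_or]
    exact Finset.card_filter_add_card_filter_not _
  · rw [Finset.disjoint_filter]
    intro S hS hPS hNS
    have := Finset.card_le_card (Finset.union_subset hPS hNS)
    rw [Finset.card_union_of_disjoint (disjoint_posIndices_negIndices a), hsum,
      (Finset.mem_powersetCard.1 hS).2] at this
    omega

end IsCircuit

end Faces

end SphericalSylvester
namespace SphericalSylvester

section Coefficients

variable {d : ℕ}

/-- The signed maximal minors of a family of `d + 2` vectors in `ℝ^{d+1}`. -/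
noncomputable def circuitCoeff (x : Fin (d + 2) → EuclideanSpace ℝ (Fin (d + 1)))
    (i : Fin (d + 2)) : ℝ :=
  (-1) ^ (i : ℕ) * Matrix.det (Matrix.of fun r c : Fin (d + 1) => x (i.succAbove r) c)

lemma sum_circuitCoeff_smul (x : Fin (d + 2) → EuclideanSpace ℝ (Fin (d + 1))) :
    ∑ i, circuitCoeff x i • x i = 0 := by
  ext k
  have hdet : Matrix.det (Matrix.of fun (r c : Fin (d + 2)) =>
      (Fin.cons (x r k) (fun j => x r j) : Fin (d + 2) → ℝ) c) = 0 := by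
    refine Matrix.det_zero_of_column_eq (i := 0) (j := k.succ) (Fin.succ_ne_zero k).symm ?_
    intro r
    simp
  rw [Matrix.det_succ_column_zero] at hdet
  simp only [WithLp.ofLp_sum, Finset.sum_apply, PiLp.smul_apply, smul_eq_mul, PiLp.zero_apply]
  rw [← hdet]
  refine Finset.sum_congr rfl fun i _ => ?_
  simp only [circuitCoeff, Matrix.of_apply, Fin.cons_zero]
  rw [mul_right_comm]
  congr 1

lemma GeneralLinearPosition.linearIndependent_succAbove
    {x : Fin (d + 2) → EuclideanSpace ℝ (Fin (d + 1))} (hx : GeneralLinearPosition x)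
    (i : Fin (d + 2)) : LinearIndependent ℝ (fun r => x (i.succAbove r)) := by
  have h := hx (Finset.univ.erase i) (by simp)
  refine LinearIndependent.comp h (fun r => ⟨i.succAbove r, by simp⟩) ?_
  intro r s hrs
  exact Fin.succAbove_right_injective (congrArg Subtype.val hrs)

lemma GeneralLinearPosition.isCircuit
    {x : Fin (d + 2) → EuclideanSpace ℝ (Fin (d + 1))} (hx : GeneralLinearPosition x) :
    IsCircuit x (circuitCoeff x) := by
  have hne : ∀ i, circuitCoeff x i ≠ 0 := by
    intro i
    have hli : LinearIndependent ℝ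
        (Matrix.of fun r c : Fin (d + 1) => x (i.succAbove r) c).row :=
      (hx.linearIndependent_succAbove i).map'
        (WithLp.linearEquiv 2 ℝ (Fin (d + 1) → ℝ)).toLinearMap (LinearEquiv.ker _)
    rw [Matrix.linearIndependent_rows_iff_isUnit, Matrix.isUnit_iff_isUnit_det] at hli
    exact mul_ne_zero (pow_ne_zero _ (by norm_num)) hli.ne_zero
  refine ⟨sum_circuitCoeff_smul x, hne, fun c hc => ⟨c 0 / circuitCoeff x 0, ?_⟩⟩
  set t := c 0 / circuitCoeff x 0
  have h0 : c 0 - t * circuitCoeff x 0 = 0 := by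
    rw [div_mul_cancel₀ _ (hne 0), sub_self]
  have hsum : ∑ i, (c i - t * circuitCoeff x i) • x i = 0 := by
    simp_rw [sub_smul, mul_smul]
    rw [Finset.sum_sub_distrib, ← Finset.smul_sum, hc, sum_circuitCoeff_smul]
    simp
  rw [Fin.sum_univ_succ, h0, zero_smul, zero_add] at hsum
  have hli := Fintype.linearIndependent_iff.1 (hx.linearIndependent_succAbove 0)
    (fun i => c i.succ - t * circuitCoeff x i.succ) (by simpa using hsum)
  intro i
  refine Fin.cases ?_ (fun i => ?_) i
  · linarith
  · linarith [hli i]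

lemma measurable_circuitCoeff {Ω : Type*} [MeasurableSpace Ω]
    {X : Fin (d + 2) → Ω → EuclideanSpace ℝ (Fin (d + 1))} (hX : ∀ i, Measurable (X i))
    (i : Fin (d + 2)) : Measurable fun ω => circuitCoeff (fun j => X j ω) i := by
  unfold circuitCoeff
  simp_rw [Matrix.det_apply]
  simp only [Matrix.of_apply]
  have h : ∀ j c, Measurable fun ω => X j ω c := fun j c =>
    (measurable_pi_apply c).comp ((WithLp.measurable_ofLp 2 _).comp (hX j))
  fun_prop

lemma measurable_card_posIndices {Ω ι : Type*} [Fintype ι] [MeasurableSpace Ω]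
    {a : Ω → ι → ℝ} (ha : ∀ i, Measurable fun ω => a ω i) :
    Measurable fun ω => (posIndices (a ω)).card := by
  simp only [posIndices, Finset.card_filter]
  exact Finset.measurable_sum _ fun i _ =>
    Measurable.ite (measurableSet_lt measurable_const (ha i)) measurable_const measurable_const

end Coefficients

namespace IsCircuit

lemma hull_eq_top_of_negIndices_eq_empty {ι E : Type*} [Fintype ι] [AddCommGroup E] [Module ℝ E]
    {x : ι → E} {a : ι → ℝ} (h : IsCircuit x a) (hx : Submodule.span ℝ (Set.range x) = ⊤)
    (hN : negIndices a = ∅) : PointedCone.hull ℝ (Set.range x) = ⊤ := by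
  rw [eq_top_iff]
  intro y _
  have hy : y ∈ Submodule.span ℝ (Set.range x) := hx ▸ Submodule.mem_top
  obtain ⟨c, rfl⟩ := (Submodule.mem_span_range_iff_exists_fun ℝ).1 hy
  have hpos : ∀ i, 0 < a i := by
    intro i
    by_contra hi
    have : i ∈ negIndices a := by
      simpa [negIndices] using lt_of_le_of_ne (not_lt.1 hi) (h.ne_zero i)
    simp [hN] at this
  refine mem_hull_range_iff.2 ⟨fun i => c i + (∑ j, |c j| / a j) * a i, fun i => ?_, ?_⟩
  · have h1 : |c i| / a i ≤ ∑ j, |c j| / a j :=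
      Finset.single_le_sum (f := fun j => |c j| / a j)
        (fun j _ => div_nonneg (abs_nonneg _) (hpos j).le) (Finset.mem_univ i)
    rw [div_le_iff₀ (hpos i)] at h1
    linarith [neg_abs_le (c i)]
  · simp_rw [add_smul, mul_smul]
    rw [Finset.sum_add_distrib, ← Finset.smul_sum, h.sum_eq_zero, smul_zero, add_zero]

lemma posIndices_eq_empty_or_of_hull_eq_top {ι E : Type*} [Fintype ι] [AddCommGroup E]
    [Module ℝ E] {x : ι → E} {a : ι → ℝ} (h : IsCircuit x a)
    (hC : PointedCone.hull ℝ (Set.range x) = ⊤) : posIndices a = ∅ ∨ negIndices a = ∅ := by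
  have hm : -∑ i, x i ∈ PointedCone.hull ℝ (Set.range x) := hC ▸ Submodule.mem_top
  obtain ⟨c, hc, hsum⟩ := mem_hull_range_iff.1 hm
  obtain ⟨t, ht⟩ := h.unique (fun i => c i + 1) (by
    simp [add_smul, Finset.sum_add_distrib, hsum])
  by_contra! hne
  obtain ⟨⟨p, hp⟩, ⟨n, hn⟩⟩ := hne
  simp only [posIndices, negIndices, Finset.mem_filter, Finset.mem_univ, true_and] at hp hn
  have hp' : 0 < t := pos_of_mul_pos_left (by linarith [ht p, hc p]) hp.le
  linarith [ht n, hc n, mul_neg_of_pos_of_neg hp' hn]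

end IsCircuit

lemma sphericalPart_eq_sphere_iff {k : ℕ} {C : PointedCone ℝ (EuclideanSpace ℝ (Fin k))} :
    sphericalPart C = Metric.sphere 0 1 ↔ C = ⊤ := by
  refine ⟨fun h => ?_, fun h => by simp [sphericalPart, h]⟩
  rw [eq_top_iff]
  intro y _
  by_cases hy : y = 0
  · rw [hy]; exact Submodule.zero_mem _
  have hmem : (‖y‖⁻¹ • y) ∈ Metric.sphere (0 : EuclideanSpace ℝ (Fin k)) 1 := by
    simp [norm_smul, hy]
  rw [← h] at hmem
  have := PointedCone.smul_mem C (norm_nonneg y) hmem.1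
  rwa [smul_smul, mul_inv_cancel₀ (norm_ne_zero_iff.2 hy), one_smul] at this

lemma add_choose_two (p q : ℕ) :
    (p + q).choose 2 = p * q + (p.choose 2 + q.choose 2) := by
  have : ((p + q).choose 2 : ℚ) = p * q + (p.choose 2 + q.choose 2) := by
    simp only [Nat.cast_choose_two]
    push_cast
    ring
  exact_mod_cast this

section FaceNumbers

variable {d : ℕ} {x : Fin (d + 2) → EuclideanSpace ℝ (Fin (d + 1))} {a : Fin (d + 2) → ℝ}

lemma IsCircuit.span_range_eq_top (h : IsCircuit x a) :
    Submodule.span ℝ (Set.range x) = ⊤ := by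
  have h1 := h.card_le_finrank_span_range
  have h2 := Submodule.finrank_le (Submodule.span ℝ (Set.range x))
  apply Submodule.eq_top_of_finrank_eq
  simp at h1 h2 ⊢
  omega

lemma IsCircuit.posHull_eq_top_iff (h : IsCircuit x a) :
    posHull x = ⊤ ↔ posIndices a = ∅ ∨ negIndices a = ∅ := by
  refine ⟨h.posIndices_eq_empty_or_of_hull_eq_top, ?_⟩
  rintro (hP | hN)
  · exact h.neg.hull_eq_top_of_negIndices_eq_empty h.span_range_eq_top
      (by simpa [posIndices, negIndices] using hP)
  · exact h.hull_eq_top_of_negIndices_eq_empty h.span_range_eq_top hN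

/-- The face numbers of the spherical polytope spanned by a circuit with `p` positive
coefficients. -/
lemma IsCircuit.sphericalFaceNumber_add (h : IsCircuit x a) {k : ℕ} (hk : k ≤ d) :
    sphericalFaceNumber (posHull x) ((k : ℤ) - 1) +
      ((posIndices a).card.choose (d + 2 - k) +
        (d + 2 - (posIndices a).card).choose (d + 2 - k)) = (d + 2).choose k := by
  have hsum := h.card_posIndices_add_card_negIndices
  rw [Fintype.card_fin] at hsum
  rw [show d + 2 - (posIndices a).card = (negIndices a).card by omega]
  rcases Nat.eq_zero_or_pos k with rfl | hk0
  · simp only [sphericalFaceNumber, Nat.cast_zero, zero_sub, if_true, ne_eq,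
      sphericalPart_eq_sphere_iff, h.posHull_eq_top_iff, Nat.sub_zero, Nat.choose_zero_right]
    by_cases hP : (posIndices a).card = 0
    · have hN : (negIndices a).card = d + 2 := by omega
      simp [Finset.card_eq_zero.1 hP, hN]
    by_cases hN : (negIndices a).card = 0
    · have hP' : (posIndices a).card = d + 2 := by omega
      simp [Finset.card_eq_zero.1 hN, hP']
    rw [Nat.choose_eq_zero_of_lt (by omega), Nat.choose_eq_zero_of_lt (by omega), if_pos]
    rw [← Finset.card_eq_zero, ← Finset.card_eq_zero (s := negIndices a)]
    tauto
  · have := h.ncard_faces_add (k := k) (by simpa using by omega)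
    rw [Fintype.card_fin] at this
    rw [← this, sphericalFaceNumber, if_neg (by omega),
      show ((k : ℤ) - 1 + 1).toNat = k by omega]
    rfl

lemma IsCircuit.hasType_iff (h : IsCircuit x a) (r : ℕ) :
    HasType (posHull x) ((d : ℤ) + 1 - r) ↔
      (posIndices a).card = r ∨ d + 2 - (posIndices a).card = r := by
  have hface := h.sphericalFaceNumber_add le_rfl
  have hsum := h.card_posIndices_add_card_negIndices
  rw [Fintype.card_fin] at hsum
  obtain ⟨q, hq⟩ : ∃ q, q = d + 2 - (posIndices a).card := ⟨_, rfl⟩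
  rw [← hq] at hface ⊢
  set p := (posIndices a).card
  have hpq : d + 2 = p + q := by omega
  rw [show d + 2 - d = 2 by omega, Nat.choose_symm_add, show (d + 2).choose 2 = p * q + (p.choose 2 + q.choose 2) by
      rw [hpq, add_choose_two]] at hface
  have hf : sphericalFaceNumber (posHull x) ((d : ℤ) - 1) = p * q := by omega
  have hd : (d : ℤ) = p + q - 2 := by omega
  rw [HasType, hf]
  push_cast
  rw [hd, ← sub_eq_zero]
  have key : ((p : ℤ) * q - (p + q - 2 + 1 - r + 1) * (p + q - 2 + 1 - (p + q - 2 + 1 - r))) =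
      (p - r) * (q - r) := by ring
  rw [key, mul_eq_zero]
  omega

end FaceNumbers

end SphericalSylvester
namespace SphericalSylvester

lemma sum_neg_one_pow_mul_choose_mul_choose {q r N : ℕ} (hq : q ≤ r + N) :
    ∑ i ∈ Finset.range (N + 1), (-1 : ℝ) ^ i * (r + i).choose r * q.choose (r + i) =
      if q = r then 1 else 0 := by
  have hterm : ∀ i, (-1 : ℝ) ^ i * (r + i).choose r * q.choose (r + i) =
      q.choose r * ((-1 : ℝ) ^ i * (q - r).choose i) := by
    intro i
    have := Nat.choose_mul (n := q) (k := r + i) (s := r) (Nat.le_add_right _ _)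
    rw [Nat.add_sub_cancel_left] at this
    have h : (q.choose (r + i) : ℝ) * (r + i).choose r = q.choose r * (q - r).choose i := by
      exact_mod_cast this
    linear_combination (-1 : ℝ) ^ i * h
  simp_rw [hterm]
  rw [← Finset.mul_sum]
  rcases lt_or_ge q r with hlt | hle
  · rw [Nat.choose_eq_zero_of_lt hlt, if_neg hlt.ne]
    simp
  have hsub : ∑ i ∈ Finset.range (N + 1), (-1 : ℝ) ^ i * (q - r).choose i =
      ∑ i ∈ Finset.range (q - r + 1), (-1 : ℝ) ^ i * (q - r).choose i := by
    symm
    refine Finset.sum_subset (Finset.range_subset_range.2 (by omega)) fun i _ hi => ?_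
    rw [Nat.choose_eq_zero_of_lt (by simpa using hi)]
    simp
  have halt : ∑ i ∈ Finset.range (q - r + 1), (-1 : ℝ) ^ i * (q - r).choose i =
      if q - r = 0 then 1 else 0 := by
    exact_mod_cast Int.alternating_sum_range_choose (n := q - r)
  rw [hsub, halt]
  by_cases h : q = r
  · simp [h]
  · rw [if_neg (by omega), if_neg h, mul_zero]

lemma sum_Icc_neg_one_eq_sum_range (g : ℤ → ℝ) (N : ℕ) :
    ∑ l ∈ Finset.Icc (-1 : ℤ) ((N : ℤ) - 1), g l = ∑ k ∈ Finset.range (N + 1), g ((k : ℤ) - 1) := by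
  symm
  refine Finset.sum_bij (fun k _ => (k : ℤ) - 1) ?_ ?_ ?_ (fun _ _ => rfl)
  · intro k hk
    simp only [Finset.mem_range, Finset.mem_Icc] at hk ⊢
    omega
  · intro k _ k' _ h
    simpa using h
  · intro l hl
    rw [Finset.mem_Icc] at hl
    exact ⟨(l + 1).toNat, by rw [Finset.mem_range]; omega, by omega⟩

section Pointwise

variable {d : ℕ} {x : Fin (d + 2) → EuclideanSpace ℝ (Fin (d + 1))} {a : Fin (d + 2) → ℝ}

lemma IsCircuit.sphericalFaceNumber_eq (h : IsCircuit x a) {k : ℕ} (hk : k ≤ d) :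
    (sphericalFaceNumber (posHull x) ((k : ℤ) - 1) : ℝ) = (d + 2).choose k -
      ((posIndices a).card.choose (d + 2 - k) +
        (d + 2 - (posIndices a).card).choose (d + 2 - k)) := by
  rw [eq_sub_iff_add_eq]
  exact_mod_cast h.sphericalFaceNumber_add hk

open Classical in
/-- The indicator of the type is a linear combination of face numbers. -/
lemma IsCircuit.sum_sphericalFaceNumber (h : IsCircuit x a) (hd : 1 ≤ d) {N : ℕ}
    (hN : 2 * N ≤ d + 2) :
    1 / 2 * eta d ((N : ℤ) - 1) * ∑ l ∈ Finset.Icc (-1 : ℤ) ((N : ℤ) - 1),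
      (-1 : ℝ) ^ (((N : ℤ) - 1) + l) * binom ((d : ℤ) - l + 1) ((d : ℤ) - ((N : ℤ) - 1) + 1) *
        (binom ((d : ℤ) + 2) (l + 1) - (sphericalFaceNumber (posHull x) l : ℝ)) =
      if HasType (posHull x) ((N : ℤ) - 1) then 1 else 0 := by
  have hp : (posIndices a).card ≤ d + 2 := by
    have := h.card_posIndices_add_card_negIndices
    rw [Fintype.card_fin] at this
    omega
  have htype := h.hasType_iff (d + 2 - N)
  rw [show (d : ℤ) + 1 - ((d + 2 - N : ℕ) : ℤ) = (N : ℤ) - 1 by omega] at htype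
  rw [sum_Icc_neg_one_eq_sum_range, ← Finset.sum_range_reflect]
  have hterm : ∀ i ∈ Finset.range (N + 1),
      (-1 : ℝ) ^ (((N : ℤ) - 1) + (((N + 1 - 1 - i : ℕ) : ℤ) - 1)) *
        binom ((d : ℤ) - (((N + 1 - 1 - i : ℕ) : ℤ) - 1) + 1) ((d : ℤ) - ((N : ℤ) - 1) + 1) *
        (binom ((d : ℤ) + 2) ((((N + 1 - 1 - i : ℕ) : ℤ) - 1) + 1) -
          (sphericalFaceNumber (posHull x) (((N + 1 - 1 - i : ℕ) : ℤ) - 1) : ℝ)) =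
      (-1 : ℝ) ^ i * (d + 2 - N + i).choose (d + 2 - N) *
          (posIndices a).card.choose (d + 2 - N + i) +
        (-1 : ℝ) ^ i * (d + 2 - N + i).choose (d + 2 - N) *
          (d + 2 - (posIndices a).card).choose (d + 2 - N + i) := by
    intro i hi
    rw [Finset.mem_range] at hi
    rw [h.sphericalFaceNumber_eq (by omega)]
    unfold binom
    rw [show ((d : ℤ) - (((N + 1 - 1 - i : ℕ) : ℤ) - 1) + 1).toNat = d + 2 - N + i by omega,
      show ((d : ℤ) - ((N : ℤ) - 1) + 1).toNat = d + 2 - N by omega,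
      show ((d : ℤ) + 2).toNat = d + 2 by omega,
      show ((((N + 1 - 1 - i : ℕ) : ℤ) - 1) + 1).toNat = N + 1 - 1 - i by omega,
      show d + 2 - (N + 1 - 1 - i) = d + 2 - N + i by omega,
      show ((N : ℤ) - 1) + (((N + 1 - 1 - i : ℕ) : ℤ) - 1) = (i : ℤ) + 2 * ((N : ℤ) - 1 - i) by
        omega, zpow_add₀ (by norm_num), zpow_mul]
    norm_num
    ring
  rw [Finset.sum_congr rfl hterm, Finset.sum_add_distrib,
    sum_neg_one_pow_mul_choose_mul_choose (by omega),
    sum_neg_one_pow_mul_choose_mul_choose (by omega), eta]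
  simp only [htype]
  split_ifs <;> first | omega | norm_num

end Pointwise

end SphericalSylvester

theorem mainTheorem7 {Ω : Type*} [MeasurableSpace Ω] (μ : Measure Ω) [IsProbabilityMeasure μ]
    (d : ℕ) (hd : 1 ≤ d)
    (X : Fin (d + 2) → Ω → EuclideanSpace ℝ (Fin (d + 1)))
    (hX : ∀ i, Measurable (X i))
    (hgen : ∀ᵐ ω ∂μ, SphericalSylvester.GeneralLinearPosition (fun i => X i ω))
    (m : ℤ) (hm : -1 ≤ m) (hm' : m ≤ ⌊(d : ℝ) / 2⌋) :
    NullMeasurableSet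
        {ω | SphericalSylvester.HasType (SphericalSylvester.posHull (fun i => X i ω)) m} μ ∧
      (∀ l ∈ Finset.Icc (-1 : ℤ) m, Integrable (fun ω =>
        (SphericalSylvester.sphericalFaceNumber
          (SphericalSylvester.posHull (fun i => X i ω)) l : ℝ)) μ) ∧
      μ.real {ω | SphericalSylvester.HasType (SphericalSylvester.posHull (fun i => X i ω)) m} =
        1 / 2 * SphericalSylvester.eta d m *
          ∑ l ∈ Finset.Icc (-1 : ℤ) m,
            (-1 : ℝ) ^ (m + l) *
              SphericalSylvester.binom ((d : ℤ) - l + 1) ((d : ℤ) - m + 1) *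
              (SphericalSylvester.binom ((d : ℤ) + 2) (l + 1) -
                ∫ ω, (SphericalSylvester.sphericalFaceNumber
                  (SphericalSylvester.posHull (fun i => X i ω)) l : ℝ) ∂μ) := by
  classical
  obtain ⟨N, rfl⟩ : ∃ N : ℕ, m = (N : ℤ) - 1 := ⟨(m + 1).toNat, by omega⟩
  have hN : 2 * N ≤ d + 2 := by
    have h1 := (Int.le_floor.1 hm')
    push_cast at h1
    have h2 : (2 * N : ℝ) ≤ d + 2 := by linarith
    exact_mod_cast h2
  have hcirc : ∀ᵐ ω ∂μ, SphericalSylvester.IsCircuit (fun i => X i ω)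
      (SphericalSylvester.circuitCoeff fun i => X i ω) :=
    hgen.mono fun ω h => h.isCircuit
  have hmeas : Measurable fun ω =>
      (SphericalSylvester.posIndices (SphericalSylvester.circuitCoeff fun i => X i ω)).card :=
    SphericalSylvester.measurable_card_posIndices (SphericalSylvester.measurable_circuitCoeff hX)
  have hnull : NullMeasurableSet
      {ω | SphericalSylvester.HasType (SphericalSylvester.posHull (fun i => X i ω))
        ((N : ℤ) - 1)} μ := by
    refine ⟨_, hmeas (MeasurableSet.of_discrete
      (s := {p : ℕ | p = d + 2 - N ∨ d + 2 - p = d + 2 - N})), ?_⟩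
    filter_upwards [hcirc] with ω h
    have := h.hasType_iff (d + 2 - N)
    rw [show (d : ℤ) + 1 - ((d + 2 - N : ℕ) : ℤ) = (N : ℤ) - 1 by omega] at this
    exact propext this
  have hint : ∀ l ∈ Finset.Icc (-1 : ℤ) ((N : ℤ) - 1), Integrable (fun ω =>
      (SphericalSylvester.sphericalFaceNumber
        (SphericalSylvester.posHull (fun i => X i ω)) l : ℝ)) μ := by
    intro l hl
    rw [Finset.mem_Icc] at hl
    obtain ⟨k, rfl⟩ : ∃ k : ℕ, l = (k : ℤ) - 1 := ⟨(l + 1).toNat, by omega⟩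
    have hk : k ≤ d := by omega
    refine Integrable.of_bound (C := ((d + 2).choose k : ℝ)) ?_ ?_
    · refine AEMeasurable.aestronglyMeasurable ⟨_, (measurable_from_nat (f := fun p : ℕ =>
        ((d + 2).choose k : ℝ) - (p.choose (d + 2 - k) + (d + 2 - p).choose (d + 2 - k)))).comp
          hmeas, ?_⟩
      filter_upwards [hcirc] with ω h
      exact h.sphericalFaceNumber_eq hk
    · filter_upwards [hcirc] with ω h
      rw [Real.norm_natCast, h.sphericalFaceNumber_eq hk]
      exact sub_le_self _ (by positivity)
  refine ⟨hnull, hint, ?_⟩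
  have hreal : μ.real {ω | SphericalSylvester.HasType
      (SphericalSylvester.posHull (fun i => X i ω)) ((N : ℤ) - 1)} =
      ∫ ω, ({ω | SphericalSylvester.HasType
        (SphericalSylvester.posHull (fun i => X i ω)) ((N : ℤ) - 1)}).indicator
          (fun _ => (1 : ℝ)) ω ∂μ := by
    rw [integral_indicator₀ hnull]
    simp
  refine hreal.trans ((integral_congr_ae (hcirc.mono fun ω h =>
    (Set.indicator_apply _ _ _).trans (h.sum_sphericalFaceNumber hd hN).symm)).trans ?_)
  rw [integral_const_mul, integral_finsetSum]
  · congr 1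
    refine Finset.sum_congr rfl fun l hl => ?_
    rw [integral_const_mul, integral_sub (integrable_const _) (hint l hl)]
    simp
  · exact fun l hl => ((integrable_const _).sub (hint l hl)).const_mul _
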